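/- Consider an asynchronous fault-prone shared memory system with a finite set $\Pi$ of clients and $n$ base objects, of which any $f<n/2$ (and any number of clients) may crash. The state of a base object is the string of bits it stores. Clients are deterministic state machines; in the course of a high-level operation they trigger arbitrary atomic read-modify-write (RMW) accesses on base objects. A triggered RMW takes effect at some later time, and its response occurs at or after that time. Let $\mathbb V$ be a finite set with initial value $v_0\in\mathbb V$, and let $D=\log_2|\mathbb V|$. An algorithm emulates a weakly regular, lock-free multi-writer multi-reader (MWMR) register over $\mathbb V$ if every client can invoke reads and writes of values of $\mathbb V$ (one operation at a time) and, in all runs with at most $f$ base-object crashes: * (weak regularity) for every run and every read $rd$ that returns in it, there is a linearization of the writes of the run together with $rd$, i.e. a sequence that contains $rd$, all complete writes and possibly some outstanding ones, that respects the real-time precedence of operations, and in which $rd$ returns the value of the latest preceding write, or $v_0$ if there is none; * (lock-freedom) in every fair run, if at some point a correct client has an outstanding operation, then some operation eventually returns. A run is fair if every RMW triggered by a correct client on a correct base object eventually gets a response and every correct client gets infinitely many opportunities to act. If $f=0$, assume moreover that the bit strings stored in each base object are self-delimiting, i.e. no string that the object stores in some run is a proper prefix of another one (for example, they all have the same length).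 Then, when write concurrency is unbounded, at least $(f+1)D$ bits must be stored in the worst case. Precisely: for all $n$, $f<n/2$, $\mathbb V$ and $v_0$ there is an $m$ such that for every finite set $\Pi$ of at least $m$ clients and every algorithm for the clients $\Pi$ and $n$ base objects that emulates a weakly regular lock-free MWMR register over $\mathbb V$ with initial value $v_0$ and tolerates $f$ base-object crashes, there are a run and a time in it at which the total number of bits stored in the base objects is at least $(f+1)D$. -/

import Mathlib

universe u v w w'

namespace RegisterEmulation

/-- High-level operations of a read/write register over the domain `V`. -/
inductive Op (V : Type v) where
  | read : Op V
  | write (x : V) : Op V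

/-- What a client does when it gets an opportunity to act inside an operation: trigger a
read-modify-write (RMW) on a base object, return from the operation, or nothing. An RMW is an
arbitrary function of the bits stored in the object, giving the new bits and a response.
The value carried by `ret` is the result of a read; for a write it is a mere acknowledgement
and is ignored. -/
inductive Output (V : Type v) (n : ℕ) (Resp : Type w') where
  | trigger (b : Fin n) (fn : List Bool → List Bool × Resp) : Output V n Resp
  | ret (x : V) : Output V n Resp
  | skip : Output V n Resp

/-- An algorithm for the clients `P` over `n` base objects: every client is a deterministic state
machine, and the state of a base object is the string of bits stored in it. -/
structure Algorithm (P : Type u) (V : Type v) (n : ℕ) where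
  /-- local states of clients -/
  Local : Type w
  /-- responses of RMWs -/
  Resp : Type w'
  /-- initial contents of the base objects -/
  contents₀ : Fin n → List Bool
  /-- initial states of the clients -/
  local₀ : P → Local
  /-- state change at the invocation of an operation -/
  onInvoke : P → Local → Op V → Local
  /-- state change and output at an opportunity to act -/
  onStep : P → Local → Local × Output V n Resp
  /-- state change at the receipt of the response of an RMW -/
  onResponse : P → Local → Resp → Local

/-- The stages of an RMW. It takes effect some time after it was triggered, and its response
occurs no earlier than that. -/
inductive Phase (Resp : Type w') where
  | triggered : Phase Resp
  | applied (x : Resp) : Phase Resp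
  | responded : Phase Resp

/-- A triggered RMW. -/
structure RMW (P : Type u) (n : ℕ) (Resp : Type w') where
  client : P
  object : Fin n
  fn : List Bool → List Bool × Resp
  phase : Phase Resp

variable {P : Type u} {V : Type v} {n : ℕ}

/-- Configurations. `op c` is the outstanding operation of client `c`, if any; `rmws` lists all
RMWs triggered so far, in the order of their triggering. -/
structure Config (A : Algorithm.{u, v, w, w'} P V n) where
  loc : P → A.Local
  op : P → Option (Op V)
  contents : Fin n → List Bool
  rmws : List (RMW P n A.Resp)
  crashedClients : Finset P
  crashedObjects : Finset (Fin n)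

/-- The initial configuration. -/
def Config.initial (A : Algorithm.{u, v, w, w'} P V n) : Config A where
  loc := A.local₀
  op := fun _ => none
  contents := A.contents₀
  rmws := []
  crashedClients := ∅
  crashedObjects := ∅

/-- The number of bits stored in the base objects. -/
def Config.storage {A : Algorithm.{u, v, w, w'} P V n} (C : Config A) : ℕ :=
  ∑ b, (C.contents b).length

/-- Actions. RMWs are named by their position in the list of triggered RMWs. -/
inductive Act (P : Type u) (V : Type v) (n : ℕ) where
  | invoke (c : P) (o : Op V) : Act P V n
  | step (c : P) : Act P V n
  | effect (k : ℕ) : Act P V n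
  | respond (k : ℕ) : Act P V n
  | crashClient (c : P) : Act P V n
  | crashObject (b : Fin n) : Act P V n

/-- The transitions of the asynchronous system in which any number of clients and at most `f`
base objects may crash. An opportunity to act that is given to a client without an outstanding
operation changes nothing. -/
inductive Step [DecidableEq P] (A : Algorithm.{u, v, w, w'} P V n) (f : ℕ) :
    Config A → Act P V n → Config A → Prop
  | invoke (C : Config A) (c : P) (o : Op V) :
      c ∉ C.crashedClients → C.op c = none →
      Step A f C (.invoke c o)
        { C with
          loc := Function.update C.loc c (A.onInvoke c (C.loc c) o)
          op := Function.update C.op c (some o) }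
  | idle (C : Config A) (c : P) :
      c ∉ C.crashedClients → C.op c = none →
      Step A f C (.step c) C
  | trigger (C : Config A) (c : P) (l : A.Local) (b : Fin n)
      (fn : List Bool → List Bool × A.Resp) :
      c ∉ C.crashedClients → C.op c ≠ none → A.onStep c (C.loc c) = (l, .trigger b fn) →
      Step A f C (.step c)
        { C with
          loc := Function.update C.loc c l
          rmws := C.rmws ++ [⟨c, b, fn, .triggered⟩] }
  | ret (C : Config A) (c : P) (l : A.Local) (x : V) :
      c ∉ C.crashedClients → C.op c ≠ none → A.onStep c (C.loc c) = (l, .ret x) →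
      Step A f C (.step c)
        { C with
          loc := Function.update C.loc c l
          op := Function.update C.op c none }
  | skip (C : Config A) (c : P) (l : A.Local) :
      c ∉ C.crashedClients → C.op c ≠ none → A.onStep c (C.loc c) = (l, .skip) →
      Step A f C (.step c) { C with loc := Function.update C.loc c l }
  | effect (C : Config A) (k : ℕ) (r : RMW P n A.Resp) :
      C.rmws[k]? = some r → r.phase = .triggered → r.object ∉ C.crashedObjects →
      Step A f C (.effect k)
        { C with
          contents := Function.update C.contents r.object (r.fn (C.contents r.object)).1
          rmws := C.rmws.set k { r with phase := .applied (r.fn (C.contents r.object)).2 } }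
  | respond (C : Config A) (k : ℕ) (r : RMW P n A.Resp) (x : A.Resp) :
      C.rmws[k]? = some r → r.phase = .applied x →
      r.client ∉ C.crashedClients → r.object ∉ C.crashedObjects →
      Step A f C (.respond k)
        { C with
          loc := Function.update C.loc r.client (A.onResponse r.client (C.loc r.client) x)
          rmws := C.rmws.set k { r with phase := .responded } }
  | crashClient (C : Config A) (c : P) :
      c ∉ C.crashedClients →
      Step A f C (.crashClient c) { C with crashedClients := insert c C.crashedClients }
  | crashObject (C : Config A) (b : Fin n) :
      b ∉ C.crashedObjects → (insert b C.crashedObjects).card ≤ f →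
      Step A f C (.crashObject b) { C with crashedObjects := insert b C.crashedObjects }

/-- `cfg 0, act 0, cfg 1, act 1, …` is a run with `T` actions (infinite if `T = ⊤`). -/
def IsRun [DecidableEq P] (A : Algorithm.{u, v, w, w'} P V n) (f : ℕ) (T : ℕ∞)
    (cfg : ℕ → Config A) (act : ℕ → Act P V n) : Prop :=
  cfg 0 = Config.initial A ∧ ∀ t : ℕ, (t : ℕ∞) < T → Step A f (cfg t) (act t) (cfg (t + 1))

/-- `C` occurs in some run. -/
def Reachable [DecidableEq P] (A : Algorithm.{u, v, w, w'} P V n) (f : ℕ) (C : Config A) : Prop :=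
  ∃ (T : ℕ) (cfg : ℕ → Config A) (act : ℕ → Act P V n),
    IsRun A f (T : ℕ∞) cfg act ∧ cfg T = C

section History

variable {A : Algorithm.{u, v, w, w'} P V n} (cfg : ℕ → Config A) (act : ℕ → Act P V n)

/-- Action `t` is the return, with result `x`, of the outstanding operation of client `c`. -/
def ReturnsAt (t : ℕ) (c : P) (x : V) : Prop :=
  act t = .step c ∧ (cfg t).op c ≠ none ∧ (A.onStep c ((cfg t).loc c)).2 = .ret x

/-- The operation invoked by action `s` returns `x` by action `t`. In what follows an operation
of a run is identified with the time of its invocation. -/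
def OpReturns (s t : ℕ) (x : V) : Prop :=
  ∃ c o, act s = .invoke c o ∧ s < t ∧ ReturnsAt cfg act t c x ∧
    ∀ r, s < r → r < t → ∀ y, ¬ ReturnsAt cfg act r c y

/-- Operation `s` returns before operation `s'` is invoked. -/
def Precedes (s s' : ℕ) : Prop :=
  ∃ t x, OpReturns cfg act s t x ∧ t < s'

/-- The value written by operation `s`, if it is a write. -/
def writtenValue (act : ℕ → Act P V n) (s : ℕ) : Option V :=
  match act s with
  | .invoke _ (.write x) => some x
  | _ => none

/-- `L₁ ++ s :: L₂` is a linearization of the writes of a run with `T` actions together with the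
read `s` with result `x`, for a register with initial value `v₀`: it contains all complete writes
and possibly some outstanding ones, it respects precedence, and `x` is the latest value written
before `s`, or `v₀` if there is none. -/
def IsLinearization (T : ℕ) (v₀ : V) (s : ℕ) (x : V) (L₁ L₂ : List ℕ) : Prop :=
  (L₁ ++ s :: L₂).Nodup ∧
  (∀ a ∈ L₁ ++ L₂, a < T ∧ writtenValue act a ≠ none) ∧
  (∀ a t y, writtenValue act a ≠ none → t < T → OpReturns cfg act a t y → a ∈ L₁ ++ L₂) ∧
  (L₁ ++ s :: L₂).Pairwise (fun a b => ¬ Precedes cfg act b a) ∧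
  (L₁.filterMap (writtenValue act)).getLastD v₀ = x

/-- Client `c` never crashes. -/
def CorrectClient (c : P) : Prop :=
  ∀ t, c ∉ (cfg t).crashedClients

/-- Base object `b` never crashes. -/
def CorrectObject (b : Fin n) : Prop :=
  ∀ t, b ∉ (cfg t).crashedObjects

/-- Fairness of an infinite run: every RMW triggered by a correct client on a correct base object
eventually gets its response, and every correct client gets infinitely many opportunities
to act. -/
def Fair : Prop :=
  (∀ (t k : ℕ) (r : RMW P n A.Resp), (cfg t).rmws[k]? = some r →
      CorrectClient cfg r.client → CorrectObject cfg r.object →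
    ∃ (t' : ℕ) (r' : RMW P n A.Resp), (cfg t').rmws[k]? = some r' ∧ r'.phase = .responded) ∧
  (∀ c, CorrectClient cfg c → ∀ t, ∃ t', t ≤ t' ∧ act t' = .step c)

end History

/-- Weak regularity: for every run and every read that returns in it, the writes of the run and
that read have a linearization. (It suffices to look at finite runs.) -/
def WeaklyRegular [DecidableEq P] (A : Algorithm.{u, v, w, w'} P V n) (f : ℕ) (v₀ : V) : Prop :=
  ∀ (T : ℕ) (cfg : ℕ → Config A) (act : ℕ → Act P V n), IsRun A f (T : ℕ∞) cfg act →
    ∀ c s t x, act s = .invoke c .read → t < T → OpReturns cfg act s t x →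
      ∃ L₁ L₂, IsLinearization cfg act T v₀ s x L₁ L₂

/-- Lock-freedom: in every fair run, if at some point a correct client has an outstanding
operation, then some operation returns later. -/
def LockFree [DecidableEq P] (A : Algorithm.{u, v, w, w'} P V n) (f : ℕ) : Prop :=
  ∀ (cfg : ℕ → Config A) (act : ℕ → Act P V n), IsRun A f ⊤ cfg act → Fair cfg act →
    ∀ t c, CorrectClient cfg c → (cfg t).op c ≠ none →
      ∃ t' c' x, t ≤ t' ∧ ReturnsAt cfg act t' c' x

/-- The bit strings that a base object ever stores are self-delimiting: no one is a proper prefix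
of another one. (Fixed-length contents are the typical case.) -/
def SelfDelimiting [DecidableEq P] (A : Algorithm.{u, v, w, w'} P V n) (f : ℕ) : Prop :=
  ∀ C C', Reachable A f C → Reachable A f C' → ∀ b,
    C.contents b <+: C'.contents b → C.contents b = C'.contents b

end RegisterEmulation

/-! For `f ≥ 1` the truth is stronger than the bound: for every `B`, enough clients force some base
object to hold more than `B` bits. Suppose no object ever does. Then there are only finitely many
content vectors, say `N`, and finitely many effects that an RMW can have on them.

A client running alone inside an operation returns even if one object is blocked
(`LockFree.exists_solo_ret`): otherwise, crashing that object and all other clients would make its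
run fair. So it can complete its operation and leave behind a pending RMW on the blocked object,
which may take effect at any later time. Collect a stock of such leftovers. In each round a fresh
client completes a write of `x`, then another fresh client starts a write of `y ≠ x`. If the latter
is about to trigger an RMW whose effect has fewer than `N` pending copies, that RMW is left pending
and the stock grows (`Quiet.trigger_dichotomy`). Since the stock truncated at `N` per effect is
bounded, some round must fail: there every effect used by the write of `y` is stocked `N` times. The
contents then pass from those after the write of `x` to those after the write of `y` through a chain
of stocked effects. Cutting cycles makes the chain shorter than `N`, so the pending RMWs alone can
replay it, with no write of `y` ever invoked. A fresh reader sees the same contents in both runs,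
but weak regularity demands `x` in one and `y` in the other (`LastWrite.eq_of_contents_eq`).

For `f = 0` nothing can be left pending in this way, and a counting argument is used: the contents
after a completed write determine the value, and self-delimiting contents can be concatenated and
padded to one common length without loss. -/

namespace RegisterEmulation

variable {P : Type u} {V : Type v} {n : ℕ}

set_option linter.unusedSectionVars false

/-! ### Finite action sequences and runs -/

section Solo

variable [DecidableEq P] {A : Algorithm.{u, v, w, w'} P V n} {f : ℕ}

/-- Transitions are deterministic once the action is known. -/
theorem Step.unique {C D D' : Config A} {a : Act P V n} (h : Step A f C a D)
    (h' : Step A f C a D') : D = D' := by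
  cases h <;> cases h' <;> simp_all

/-- `Path A f C α D`: the actions `α` lead from `C` to `D`. -/
inductive Path (A : Algorithm.{u, v, w, w'} P V n) (f : ℕ) :
    Config A → List (Act P V n) → Config A → Prop
  | nil (C : Config A) : Path A f C [] C
  | cons {C C' D : Config A} {a : Act P V n} {α : List (Act P V n)} :
      Step A f C a C' → Path A f C' α D → Path A f C (a :: α) D

theorem Path.single {C D : Config A} {a : Act P V n} (h : Step A f C a D) : Path A f C [a] D :=
  .cons h (.nil D)

theorem Path.append {C D E : Config A} {α β : List (Act P V n)} (h : Path A f C α D)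
    (h' : Path A f D β E) : Path A f C (α ++ β) E := by
  induction h with
  | nil => exact h'
  | cons hs _ ih => exact .cons hs (ih h')

theorem Path.unique {C D D' : Config A} {α : List (Act P V n)} (h : Path A f C α D)
    (h' : Path A f C α D') : D = D' := by
  induction h with
  | nil => cases h'; rfl
  | cons hs _ ih =>
    cases h' with
    | cons hs' hp' =>
      cases hs.unique hs'
      exact ih hp'

theorem Path.split {C D : Config A} {α β : List (Act P V n)} (h : Path A f C (α ++ β) D) :
    ∃ E, Path A f C α E ∧ Path A f E β D := by
  induction α generalizing C with
  | nil => exact ⟨C, .nil C, h⟩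
  | cons a α ih =>
    cases h with
    | cons hs hp =>
      obtain ⟨E, h₁, h₂⟩ := ih hp
      exact ⟨E, .cons hs h₁, h₂⟩

theorem Path.step_of_append_singleton {C D E : Config A} {α : List (Act P V n)} {a : Act P V n}
    (h : Path A f C α D) (h' : Path A f C (α ++ [a]) E) : Step A f D a E := by
  obtain ⟨D', h₁, h₂⟩ := h'.split
  cases h.unique h₁
  cases h₂ with
  | cons hs hp => cases hp; exact hs

/-- The configurations along a path from `C`. -/
noncomputable def trace (f : ℕ) (C : Config A) (α : List (Act P V n)) : Config A :=
  open Classical in if h : ∃ D, Path A f C α D then h.choose else C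

theorem Path.trace_eq {C D : Config A} {α : List (Act P V n)} (h : Path A f C α D) :
    trace f C α = D := by
  have hex : ∃ D, Path A f C α D := ⟨D, h⟩
  rw [trace, dif_pos hex]
  exact hex.choose_spec.unique h

theorem Path.step_trace {C D : Config A} {α : List (Act P V n)} (h : Path A f C α D)
    {t : ℕ} (ht : t < α.length) :
    Step A f (trace f C (α.take t)) α[t] (trace f C (α.take (t + 1))) := by
  obtain ⟨E, h₁, -⟩ := Path.split (α := α.take t) (β := α.drop t) (by simpa using h)
  obtain ⟨E', h₁', -⟩ := Path.split (α := α.take (t + 1)) (β := α.drop (t + 1)) (by simpa using h)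
  rw [h₁.trace_eq, h₁'.trace_eq]
  rw [List.take_succ_eq_append_getElem ht] at h₁'
  exact h₁.step_of_append_singleton h₁'

/-- Since actions determine transitions, each prefix of `α` has a well-defined final configuration.
This turns paths, which are easy to concatenate, into the time-indexed runs of the hypotheses; `d`
only pads the action sequence past its end. -/
theorem Path.isRun {D : Config A} {α : List (Act P V n)}
    (h : Path A f (Config.initial A) α D) (d : Act P V n) :
    IsRun A f (α.length : ℕ∞) (fun t => trace f (Config.initial A) (α.take t))
      (fun t => α.getD t d) := by
  refine ⟨by simpa using (Path.nil _).trace_eq, fun t ht => ?_⟩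
  have ht' : t < α.length := by exact_mod_cast ht
  have e : α.getD t d = α[t] := List.getD_eq_getElem _ _ ht'
  simp only [e]
  exact h.step_trace ht'

theorem Path.reachable {D : Config A} {α : List (Act P V n)}
    (h : Path A f (Config.initial A) α D) : Reachable A f D :=
  ⟨α.length, _, _, h.isRun (.effect 0), by simpa using h.trace_eq⟩

/-- `a` invokes no operation. -/
def Act.NotInvoke (a : Act P V n) : Prop := ∀ c o, a ≠ .invoke c o

theorem Step.op_eq_none {C D : Config A} {a : Act P V n} (h : Step A f C a D)
    (ha : a.NotInvoke) {c : P} (hc : C.op c = none) : D.op c = none := by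
  cases h with
  | invoke c o => exact absurd rfl (ha c o)
  | ret c' => by_cases hcc : c = c' <;> simp [Function.update, hcc, hc]
  | _ => exact hc

theorem Path.op_eq_none {C D : Config A} {α : List (Act P V n)} (h : Path A f C α D)
    (hα : ∀ a ∈ α, a.NotInvoke) {c : P} (hc : C.op c = none) : D.op c = none := by
  induction h with
  | nil => exact hc
  | cons hs _ ih =>
    exact ih (fun a ha => hα a (by simp [ha])) (hs.op_eq_none (hα _ (by simp)) hc)

/-- An outstanding operation ends only by a return. -/
theorem Step.exists_ret {C D : Config A} {a : Act P V n} (h : Step A f C a D) {c : P}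
    (hc : C.op c ≠ none) (hd : D.op c = none) :
    a = .step c ∧ ∃ x, (A.onStep c (C.loc c)).2 = .ret x := by
  cases h with
  | invoke c' o =>
    by_cases hcc : c = c'
    · subst hcc; simp at hd
    · simp [Function.update, hcc] at hd; exact absurd hd hc
  | ret c' l x h₁ h₂ h₃ =>
    by_cases hcc : c = c'
    · subst hcc; exact ⟨rfl, x, by rw [h₃]⟩
    · simp [Function.update, hcc] at hd; exact absurd hd hc
  | _ => exact absurd hd hc

theorem Step.op_of_returns {C D : Config A} {c : P} {x : V} (h : Step A f C (.step c) D)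
    (hc : C.op c ≠ none) (hx : (A.onStep c (C.loc c)).2 = .ret x) : D.op c = none := by
  cases h <;> simp_all

theorem Step.op_of_invoke {C D : Config A} {c : P} {o : Op V} (h : Step A f C (.invoke c o) D) :
    D.op c = some o := by
  cases h; simp

/-- An operation that is no longer outstanding has returned. -/
theorem IsRun.exists_opReturns {T : ℕ∞} {cfg : ℕ → Config A} {act : ℕ → Act P V n}
    (h : IsRun A f T cfg act) {s t : ℕ} (hst : s < t) (ht : (t : ℕ∞) ≤ T) {c : P} {o : Op V}
    (hs : act s = .invoke c o) (hop : (cfg t).op c = none) :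
    ∃ r < t, ∃ x, OpReturns cfg act s r x := by
  classical
  have hex : ∃ r, s < r ∧ (cfg (r + 1)).op c = none := by
    have h1 : (cfg (s + 1)).op c ≠ none := by
      have := h.2 s (lt_of_lt_of_le (by exact_mod_cast hst) ht)
      rw [hs] at this
      simp_all [this.op_of_invoke]
    obtain ⟨k, rfl⟩ : ∃ k, t = k + 1 := ⟨t - 1, by omega⟩
    refine ⟨k, ?_, hop⟩
    rcases Nat.lt_or_ge s k with hk | hk
    · exact hk
    · obtain rfl : s = k := by omega
      exact absurd hop h1
  -- Minimality of `r` makes this the first return of `c` after `s`, as `OpReturns` requires.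
  let r := Nat.find hex
  have hr : s < r ∧ (cfg (r + 1)).op c = none := Nat.find_spec hex
  have hmin : ∀ q < r, ¬ (s < q ∧ (cfg (q + 1)).op c = none) := fun q hq => Nat.find_min hex hq
  have hrt : r < t := by
    obtain ⟨k, rfl⟩ : ∃ k, t = k + 1 := ⟨t - 1, by omega⟩
    rcases Nat.lt_or_ge s k with hk | hk
    · exact Nat.lt_succ_of_le (Nat.find_min' hex ⟨hk, hop⟩)
    · obtain rfl : s = k := by omega
      have := h.2 s (lt_of_lt_of_le (by exact_mod_cast hst) ht)
      rw [hs] at this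
      simp_all [this.op_of_invoke]
  have hpre : ∀ q, s < q → q ≤ r → (cfg q).op c ≠ none := by
    intro q hsq hqr
    rcases Nat.lt_or_ge (s + 1) q with h' | h'
    · obtain ⟨k, rfl⟩ : ∃ k, q = k + 1 := ⟨q - 1, by omega⟩
      exact fun hk => hmin k (by omega) ⟨by omega, hk⟩
    · obtain rfl : q = s + 1 := by omega
      have := h.2 s (lt_of_lt_of_le (by exact_mod_cast hst) ht)
      rw [hs] at this
      simp_all [this.op_of_invoke]
  have hlt : ∀ q : ℕ, q ≤ r → (q : ℕ∞) < T := fun q hq =>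
    lt_of_lt_of_le (by exact_mod_cast (by omega : q < t)) ht
  obtain ⟨ha, x, hx⟩ := (h.2 r (hlt r le_rfl)).exists_ret (hpre r hr.1 le_rfl) hr.2
  refine ⟨r, hrt, x, c, o, hs, hr.1, ⟨ha, hpre r hr.1 le_rfl, hx⟩, ?_⟩
  rintro q hsq hqr y ⟨h₁, h₂, h₃⟩
  have := h.2 q (hlt q hqr.le)
  rw [h₁] at this
  exact hpre (q + 1) (by omega) (by omega) (this.op_of_returns h₂ h₃)

/-! ### Reads after the last write -/

/-- At a configuration where no operation is outstanding, `x` is the value of the last write. -/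
def LastWrite (f : ℕ) (C : Config A) (x : V) : Prop :=
  ∃ (α β : List (Act P V n)) (c : P) (D : Config A),
    Path A f (Config.initial A) α D ∧ (∀ d, D.op d = none) ∧
    Path A f D (.invoke c (.write x) :: β) C ∧ (∀ d, C.op d = none) ∧ ∀ a ∈ β, a.NotInvoke

theorem LastWrite.path {C D : Config A} {x : V} (h : LastWrite f C x) {α : List (Act P V n)}
    (hα : ∀ a ∈ α, a.NotInvoke) (hp : Path A f C α D) : LastWrite f D x := by
  obtain ⟨γ, β, c, E, h₁, h₂, h₃, h₄, h₅⟩ := h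
  refine ⟨γ, β ++ α, c, E, h₁, h₂, by simpa using h₃.append hp,
    fun d => hp.op_eq_none hα (h₄ d), ?_⟩
  intro a ha
  rcases List.mem_append.1 ha with ha | ha
  exacts [h₅ a ha, hα a ha]

/-- A read that runs after the last write has returned, while no other operation is outstanding,
returns the value of that write. -/
theorem LastWrite.read_eq {v₀ : V} (hreg : WeaklyRegular A f v₀) {C D : Config A} {x y : V}
    (h : LastWrite f C x) {c : P} {δ : List (Act P V n)} (hδ : ∀ a ∈ δ, a.NotInvoke)
    (hp : Path A f C (.invoke c .read :: δ) D) (hc : c ∉ D.crashedClients)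
    (hop : D.op c ≠ none) (hy : (A.onStep c (D.loc c)).2 = .ret y) : y = x := by
  obtain ⟨α, β, c₁, E, h₁, hE, h₂, hC, hβ⟩ := h
  obtain ⟨D', hD'⟩ : ∃ D', Step A f D (.step c) D' := by
    cases he : A.onStep c (D.loc c) with
    | mk l out =>
      rw [he] at hy
      obtain rfl : out = .ret y := hy
      exact ⟨_, .ret D c l y hc hop he⟩
  have hD'c := hD'.op_of_returns hop hy
  set p := α.length with hpdef
  set s := p + 1 + β.length with hsdef
  set r := s + 1 + δ.length with hrdef
  let L : List (Act P V n) :=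
    α ++ (.invoke c₁ (.write x) :: β) ++ (.invoke c .read :: δ) ++ [.step c]
  have hfull : Path A f (Config.initial A) L D' :=
    ((h₁.append h₂).append hp).append (.single hD')
  have hlen : L.length = r + 1 := by simp [L]; omega
  -- The padding action is not an invocation, so `hlate` below also holds past the end of the run.
  have hrun := hfull.isRun (.effect 0)
  rw [hlen] at hrun
  set cfg : ℕ → Config A := fun t => trace f (Config.initial A) (L.take t) with hcfg
  set act : ℕ → Act P V n := fun t => L.getD t (.effect 0) with hact
  have hcp : cfg p = E := by
    have : L.take p = α := by simp [L, hpdef]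
    simp only [hcfg, this, h₁.trace_eq]
  have hcs : cfg s = C := by
    have : L.take s = α ++ (.invoke c₁ (.write x) :: β) := by
      have e : s = (α ++ (.invoke c₁ (.write x) :: β : List (Act P V n))).length := by simp; omega
      simp only [L]
      rw [List.append_assoc, e, List.take_left]
    simp only [hcfg, this, (h₁.append h₂).trace_eq]
  have hcr : cfg (r + 1) = D' := by
    have : L.take (r + 1) = L := by rw [← hlen, List.take_length]
    simp only [hcfg, this, hfull.trace_eq]
  have hap : act p = .invoke c₁ (.write x) := by
    simp [hact, L, hpdef, List.getD_eq_getElem?_getD]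
  have has : act s = .invoke c .read := by
    simp only [hact, L, List.getD_eq_getElem?_getD]
    rw [List.append_assoc, List.getElem?_append_right (by simp; omega)]
    have : s - (α ++ (.invoke c₁ (.write x) :: β : List (Act P V n))).length = 0 := by
      simp; omega
    rw [this]; simp
  have har : act r = .step c := by
    simp only [hact, L, List.getD_eq_getElem?_getD]
    rw [List.getElem?_append_right (by simp; omega)]
    have : r - (α ++ (.invoke c₁ (.write x) :: β) ++
        (.invoke c .read :: δ : List (Act P V n))).length = 0 := by
      simp; omega
    rw [this]; simp
  -- No write is invoked after time `p`, and by `hearly` all writes invoked before `p` have returned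
  -- by then. Hence no write can follow `p` in a linearization, while `p` itself must come before
  -- the read.
  have hlate : ∀ t, p < t → t ≠ s → writtenValue act t = none := by
    intro t hpt hts
    have hni : (act t).NotInvoke := by
      have hmem : t < r + 1 → act t ∈ β ∨ act t ∈ δ ∨ act t = .step c := by
        intro htr
        simp only [hact, L, List.getD_eq_getElem?_getD]
        rcases Nat.lt_or_ge t s with h | h
        · left
          obtain ⟨i, rfl⟩ : ∃ i, t = p + 1 + i := ⟨t - (p + 1), by omega⟩
          have hi : i < β.length := by omega
          have e : p + 1 + i - α.length = i + 1 := by omega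
          rw [List.append_assoc, List.append_assoc, List.getElem?_append_right (by omega), e]
          simp [List.getElem?_append_left hi, hi]
        · right
          rcases Nat.lt_or_ge t r with h' | h'
          · left
            obtain ⟨i, rfl⟩ : ∃ i, t = s + 1 + i := ⟨t - (s + 1), by omega⟩
            have hi : i < δ.length := by omega
            rw [List.append_assoc, List.getElem?_append_right (by simp; omega)]
            have e : s + 1 + i - (α ++ (.invoke c₁ (.write x) :: β : List (Act P V n))).length
                = i + 1 := by simp; omega
            rw [e]
            simp [List.getElem?_append_left hi, hi]
          · right
            obtain rfl : t = r := by omega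
            exact har
      by_cases htr : t < r + 1
      · rcases hmem htr with h | h | h
        · exact hβ _ h
        · exact hδ _ h
        · rw [h]; intro _ _; simp
      · have : act t = .effect 0 := by
          simp only [hact, List.getD_eq_getElem?_getD]
          rw [List.getElem?_eq_none (by omega)]; rfl
        rw [this]; intro _ _; simp
    unfold writtenValue
    split
    · rename_i c' x' he; exact absurd he (hni _ _)
    · rfl
  have hwp : writtenValue act p = some x := by simp [writtenValue, hap]
  have hws : writtenValue act s = none := by simp [writtenValue, has]
  have hearly : ∀ a < p, writtenValue act a ≠ none → Precedes cfg act a p := by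
    intro a hap' ha
    unfold writtenValue at ha
    split at ha
    · rename_i c' x' he
      obtain ⟨r', hr', z, hz⟩ := hrun.exists_opReturns hap'
        (by exact_mod_cast (by omega : p ≤ r + 1)) he (by rw [hcp]; exact hE _)
      exact ⟨r', z, hz, hr'⟩
    · exact absurd rfl ha
  obtain ⟨rp, hrp, xp, hxp⟩ := hrun.exists_opReturns (show p < s by omega)
    (by exact_mod_cast (by omega : s ≤ r + 1)) hap (by rw [hcs]; exact hC _)
  have hprec : Precedes cfg act p s := ⟨rp, xp, hxp, hrp⟩
  -- `exists_opReturns` only yields some return by time `r`. An earlier one would leave `c` without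
  -- an operation at time `r`, because nothing is invoked in between; this contradicts `hop`.
  have hret : ∃ z, OpReturns cfg act s r z ∧ z = y := by
    have hsr : s < r + 1 := by omega
    obtain ⟨r', hr', z, hz⟩ := hrun.exists_opReturns hsr le_rfl has (by rw [hcr]; exact hD'c)
    have hcrD : cfg r = D := by
      have : L.take r = α ++ (.invoke c₁ (.write x) :: β) ++ (.invoke c .read :: δ) := by
        have e : r = (α ++ (.invoke c₁ (.write x) :: β) ++
          (.invoke c .read :: δ : List (Act P V n))).length := by simp; omega
        simp only [L]
        rw [e, List.take_left]
      simp only [hcfg, this, ((h₁.append h₂).append hp).trace_eq]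
    obtain ⟨c', o', e', hs', ⟨g₁, g₂, g₃⟩, g₄⟩ := hz
    obtain ⟨rfl, rfl⟩ : c = c' ∧ Op.read = o' := by
      rw [has] at e'; simpa using e'
    rcases Nat.lt_or_ge r' r with hlt | hge
    · exfalso
      have hst := hrun.2 r' (by exact_mod_cast (by omega : r' < r + 1))
      rw [g₁] at hst
      have hn := hst.op_of_returns g₂ g₃
      have hpers : ∀ k, r' + 1 + k ≤ r → (cfg (r' + 1 + k)).op c = none := by
        intro k
        induction k with
        | zero => intro _; exact hn
        | succ k ih =>
          intro hk
          have hstk := hrun.2 (r' + 1 + k) (by exact_mod_cast (by omega : r' + 1 + k < r + 1))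
          refine hstk.op_eq_none ?_ (ih (by omega))
          obtain ⟨i, hi⟩ : ∃ i, r' + 1 + k = s + 1 + i := ⟨r' + k - s, by omega⟩
          have hi' : i < δ.length := by omega
          have : act (s + 1 + i) ∈ δ := by
            simp only [hact, L, List.getD_eq_getElem?_getD]
            rw [List.append_assoc, List.getElem?_append_right (by simp; omega)]
            have e : s + 1 + i - (α ++ (.invoke c₁ (.write x) :: β : List (Act P V n))).length
                = i + 1 := by simp; omega
            rw [e]
            simp [List.getElem?_append_left hi', hi']
          rw [hi]
          exact hδ _ this
      have := hpers (r - (r' + 1)) (by omega)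
      rw [show r' + 1 + (r - (r' + 1)) = r by omega, hcrD] at this
      exact hop this
    · obtain rfl : r' = r := by omega
      refine ⟨z, ⟨c, .read, has, by omega, ⟨g₁, g₂, g₃⟩, g₄⟩, ?_⟩
      rw [hcrD, hy] at g₃
      exact ((Output.ret.injEq _ _).mp g₃).symm
  obtain ⟨z, hz, rfl⟩ := hret
  obtain ⟨L₁, L₂, hnd, hmem, hcompl, hpw, hlast⟩ :=
    hreg (r + 1) cfg act hrun c s r z has (Nat.lt_succ_self r) hz
  have hpmem : p ∈ L₁ := by
    have := hcompl p rp xp (by simp [hwp]) (by omega) hxp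
    rcases List.mem_append.1 this with h | h
    · exact h
    · exfalso
      have := (List.pairwise_cons.1 (List.pairwise_append.1 hpw).2.1).1 p h
      exact this hprec
  obtain ⟨M₁, M₂, rfl⟩ := List.append_of_mem hpmem
  have hM₂ : M₂ = [] := by
    rcases List.eq_nil_or_concat M₂ with h | ⟨M, a, rfl⟩
    · exact h
    · exfalso
      have hapair : ¬ Precedes cfg act a p := by
        have := (List.pairwise_append.1 hpw).1
        exact (List.pairwise_cons.1 (List.pairwise_append.1 this).2.1).1 a (by simp)
      have hane : a ≠ p := by
        rintro rfl
        have := (List.nodup_append.1 hnd).1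
        have := (List.nodup_append.1 this).2.1
        simp at this
      have haw := (hmem a (by simp)).2
      rcases lt_trichotomy a p with h | h | h
      · exact hapair (hearly a h haw)
      · exact hane h
      · by_cases has' : a = s
        · exact haw (has' ▸ hws)
        · exact haw (hlate a h has')
  subst hM₂
  rw [← hlast]
  simp [List.filterMap_append, hwp]

/-! ### Solo runs and lock-freedom -/

/-- A client that runs alone acts once: an RMW that it triggers takes effect and is responded to
at once, except on the blocked objects `B`, where it stays pending. -/
def soloStep (A : Algorithm.{u, v, w, w'} P V n) (B : Finset (Fin n)) (c : P)
    (X : A.Local × (Fin n → List Bool)) : A.Local × (Fin n → List Bool) :=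
  match A.onStep c X.1 with
  | (l, .trigger b fn) =>
    if b ∈ B then (l, X.2)
    else (A.onResponse c l (fn (X.2 b)).2, Function.update X.2 b (fn (X.2 b)).1)
  | (l, .ret _) => (l, X.2)
  | (l, .skip) => (l, X.2)

/-- Change the local state of a client and the contents, and append RMWs. -/
def Config.extend (C : Config A) (c : P) (X : A.Local × (Fin n → List Bool))
    (rs : List (RMW P n A.Resp)) : Config A :=
  { C with
    loc := Function.update C.loc c X.1
    contents := X.2
    rmws := C.rmws ++ rs }

theorem Config.extend_self (C : Config A) (c : P) : C.extend c (C.loc c, C.contents) [] = C := by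
  simp [Config.extend]

theorem Config.extend_extend (C : Config A) (c : P) (X Y : A.Local × (Fin n → List Bool))
    (rs rs' : List (RMW P n A.Resp)) :
    (C.extend c X rs).extend c Y rs' = C.extend c Y (rs ++ rs') := by
  simp [Config.extend]

/-- All RMWs of `c` in the list are responded or pending on the blocked objects. -/
def Settled (B : Finset (Fin n)) (c : P) (rs : List (RMW P n A.Resp)) : Prop :=
  ∀ r ∈ rs, r.client = c → r.object ∈ B ∨ r.phase = .responded

/-- Trigger, effect and response are scheduled back to back on an unblocked object; on a blocked one
the schedule stops after the trigger. Blocking is mere delay, so the objects in `B` need not have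
crashed. The last clause identifies the RMW that is left pending. -/
theorem exists_path_soloStep {C : Config A} {c : P} {B : Finset (Fin n)}
    (hc : c ∉ C.crashedClients) (hop : C.op c ≠ none) (hB : ∀ b, b ∉ B → b ∉ C.crashedObjects)
    (hr : ∀ x, (A.onStep c (C.loc c)).2 ≠ .ret x) :
    ∃ (α : List (Act P V n)) (rs : List (RMW P n A.Resp)),
      Path A f C (.step c :: α) (C.extend c (soloStep A B c (C.loc c, C.contents)) rs) ∧
      (∀ a ∈ α, a.NotInvoke) ∧ (∀ r ∈ rs, r.client = c) ∧ Settled B c rs ∧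
      ∀ b fn, (A.onStep c (C.loc c)).2 = .trigger b fn → b ∈ B →
        rs = [RMW.mk c b fn .triggered] := by
  cases he : A.onStep c (C.loc c) with
  | mk l out =>
    rw [he] at hr
    cases out with
    | ret x => exact absurd rfl (hr x)
    | skip =>
      refine ⟨[], [], ?_, by simp, by simp, by simp [Settled], by simp⟩
      have := Step.skip (f := f) C c l hc hop he
      simpa [Config.extend, soloStep, he] using Path.single this
    | trigger b fn =>
      have h₁ := Step.trigger (f := f) C c l b fn hc hop he
      by_cases hb : b ∈ B
      · refine ⟨[], [RMW.mk c b fn .triggered], ?_, by simp, by simp, ?_, ?_⟩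
        · simpa [Config.extend, soloStep, he, hb] using Path.single h₁
        · intro r hr' _
          simp only [List.mem_singleton] at hr'
          subst hr'; exact Or.inl hb
        · intro b' fn' h' _
          simp only [Output.trigger.injEq] at h'
          obtain ⟨rfl, rfl⟩ := h'
          rfl
      · have h₂ := Step.effect (f := f) { C with
            loc := Function.update C.loc c l
            rmws := C.rmws ++ [⟨c, b, fn, .triggered⟩] } C.rmws.length (RMW.mk c b fn .triggered)
            (by simp) rfl (hB b hb)
        have h₃ := Step.respond (f := f) { C with
            loc := Function.update C.loc c l
            contents := Function.update C.contents b (fn (C.contents b)).1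
            rmws := (C.rmws ++ [RMW.mk c b fn .triggered]).set C.rmws.length
              (RMW.mk c b fn (.applied (fn (C.contents b)).2)) } C.rmws.length
            (RMW.mk c b fn (.applied (fn (C.contents b)).2)) (fn (C.contents b)).2
            (by simp) rfl hc (hB b hb)
        refine ⟨[.effect C.rmws.length, .respond C.rmws.length],
          [RMW.mk c b fn .responded], ?_, ?_, by simp, by simp [Settled], ?_⟩
        · refine .cons h₁ (.cons h₂ ?_)
          simpa [Config.extend, soloStep, he, hb] using Path.single h₃
        · intro a ha
          simp only [List.mem_cons, List.not_mem_nil, or_false] at ha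
          rcases ha with rfl | rfl <;> intro _ _ <;> simp
        · intro b' fn' h' hb'
          simp only [Output.trigger.injEq] at h'
          exact absurd (h'.1 ▸ hb') hb

theorem exists_path_iterate {C : Config A} {c : P} {B : Finset (Fin n)}
    (hc : c ∉ C.crashedClients) (hop : C.op c ≠ none) (hB : ∀ b, b ∉ B → b ∉ C.crashedObjects)
    (k : ℕ) (hr : ∀ i < k, ∀ x,
      (A.onStep c ((soloStep A B c)^[i] (C.loc c, C.contents)).1).2 ≠ .ret x) :
    ∃ (α : List (Act P V n)) (rs : List (RMW P n A.Resp)),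
      Path A f C α (C.extend c ((soloStep A B c)^[k] (C.loc c, C.contents)) rs) ∧
      (∀ a ∈ α, a.NotInvoke) ∧ (∀ r ∈ rs, r.client = c) ∧ Settled B c rs := by
  induction k with
  | zero =>
    refine ⟨[], [], ?_, by simp, by simp, by simp [Settled]⟩
    rw [Function.iterate_zero_apply, Config.extend_self]
    exact .nil C
  | succ k ih =>
    obtain ⟨α, rs, hp, hα, hrs, hs⟩ := ih fun i hi => hr i (by omega)
    set X := (soloStep A B c)^[k] (C.loc c, C.contents) with hX
    have hl : (C.extend c X rs).loc c = X.1 := by simp [Config.extend]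
    obtain ⟨α', rs', hp', hα', hrs', hs', -⟩ := exists_path_soloStep (f := f) (C := C.extend c X rs)
      (c := c) (B := B) hc hop hB (by rw [hl]; exact hr k (by omega))
    refine ⟨α ++ .step c :: α', rs ++ rs', ?_, ?_, ?_, ?_⟩
    · rw [Function.iterate_succ_apply', ← hX]
      rw [Config.extend_extend, hl] at hp'
      exact hp.append hp'
    · intro a ha
      simp only [List.mem_append, List.mem_cons] at ha
      rcases ha with ha | rfl | ha
      · exact hα a ha
      · intro _ _; simp
      · exact hα' a ha
    · intro r hr'
      rcases List.mem_append.1 hr' with h | h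
      exacts [hrs r h, hrs' r h]
    · intro r hr'
      rcases List.mem_append.1 hr' with h | h
      exacts [hs r h, hs' r h]

theorem exists_path_crash {C : Config A} {s : Finset P} {B : Finset (Fin n)} (hB : B.card ≤ f)
    (hc : C.crashedClients = ∅) (ho : C.crashedObjects = ∅) :
    ∃ α, Path A f C α { C with crashedClients := s, crashedObjects := B } := by
  have h₁ : ∃ α, Path A f C α { C with crashedClients := s } := by
    induction s using Finset.induction_on with
    | empty => exact ⟨[], by rw [← hc]; exact .nil C⟩
    | insert d s hd ih =>
      obtain ⟨α, hα⟩ := ih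
      exact ⟨_, hα.append (.single (.crashClient _ d hd))⟩
  have h₂ : ∃ α, Path A f { C with crashedClients := s } α
      { C with crashedClients := s, crashedObjects := B } := by
    clear h₁
    induction B using Finset.induction_on with
    | empty => exact ⟨[], by rw [← ho]; exact .nil _⟩
    | insert b B hb ih =>
      obtain ⟨α, hα⟩ := ih ((Finset.card_le_card (Finset.subset_insert _ _)).trans hB)
      exact ⟨_, hα.append (.single (.crashObject _ b hb hB))⟩
  obtain ⟨α, hα⟩ := h₁
  obtain ⟨β, hβ⟩ := h₂
  exact ⟨_, hα.append hβ⟩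

theorem Step.exists_rmw {C D : Config A} {a : Act P V n} (h : Step A f C a D) {k : ℕ}
    {r : RMW P n A.Resp} (hr : C.rmws[k]? = some r) :
    ∃ r', D.rmws[k]? = some r' ∧ r'.client = r.client ∧ r'.object = r.object := by
  have hk : k < C.rmws.length := (List.getElem?_eq_some_iff.1 hr).1
  cases h with
  | trigger => exact ⟨r, by simp [List.getElem?_append_left hk, hr], rfl, rfl⟩
  | effect j r' hj =>
    by_cases hjk : j = k
    · subst hjk
      obtain rfl : r = r' := by rw [hr] at hj; exact Option.some.inj hj
      exact ⟨_, List.getElem?_set_self hk, rfl, rfl⟩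
    · exact ⟨r, by simp [List.getElem?_set_ne hjk, hr], rfl, rfl⟩
  | respond j r' x hj =>
    by_cases hjk : j = k
    · subst hjk
      obtain rfl : r = r' := by rw [hr] at hj; exact Option.some.inj hj
      exact ⟨_, List.getElem?_set_self hk, rfl, rfl⟩
    · exact ⟨r, by simp [List.getElem?_set_ne hjk, hr], rfl, rfl⟩
  | _ => exact ⟨r, hr, rfl, rfl⟩

theorem Step.crashedClients_subset {C D : Config A} {a : Act P V n} (h : Step A f C a D) :
    C.crashedClients ⊆ D.crashedClients := by
  cases h with
  | crashClient c => exact Finset.subset_insert _ _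
  | _ => exact subset_rfl

theorem Step.notMem_crashedClients {C D : Config A} {c : P} (h : Step A f C (.step c) D) :
    c ∉ C.crashedClients := by
  cases h <;> assumption

/-- A client that runs alone inside an operation, with at most `f` blocked objects, returns. -/
theorem LockFree.exists_solo_ret [Fintype P] (hlf : LockFree A f) {C : Config A}
    {α : List (Act P V n)} (hp : Path A f (Config.initial A) α C)
    (hcc : C.crashedClients = ∅) (hco : C.crashedObjects = ∅) {c : P} (hop : C.op c ≠ none)
    {B : Finset (Fin n)} (hB : B.card ≤ f) (hs : Settled B c C.rmws) :
    ∃ k x, (A.onStep c ((soloStep A B c)^[k] (C.loc c, C.contents)).1).2 = .ret x := by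
  by_contra! hno
  -- Crashing exactly the blocked objects and all other clients makes the endless solo schedule
  -- fair: whatever `c` has left unanswered lies on a crashed object.
  obtain ⟨γ, hγ⟩ := exists_path_crash (A := A) (s := Finset.univ.erase c) hB hcc hco
  let Inv : Config A → Prop := fun D => D.op c ≠ none ∧ D.crashedClients = Finset.univ.erase c ∧
    D.crashedObjects = B ∧ Settled B c D.rmws ∧
    ∀ k x, (A.onStep c ((soloStep A B c)^[k] (D.loc c, D.contents)).1).2 ≠ .ret x
  have hnext : ∀ D : {D // Inv D}, ∃ q : List (Act P V n) × {D // Inv D},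
      Path A f D.1 (.step c :: q.1) q.2.1 ∧ ∀ a ∈ q.1, a.NotInvoke := by
    rintro ⟨D, h₁, h₂, h₃, h₄, h₅⟩
    obtain ⟨β, rs, hβ, hβi, -, hrs, -⟩ := exists_path_soloStep (f := f) (C := D) (c := c) (B := B)
      (by simp [h₂]) h₁ (by simp [h₃]) (h₅ 0)
    refine ⟨(β, ⟨D.extend c (soloStep A B c (D.loc c, D.contents)) rs, h₁, h₂, h₃, ?_, ?_⟩),
      hβ, hβi⟩
    · intro r hr
      rcases List.mem_append.1 hr with h | h
      exacts [h₄ r h, hrs r h]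
    · intro k x
      have := h₅ (k + 1) x
      rw [Function.iterate_succ_apply] at this
      simpa [Config.extend] using this
  choose q hq hqi using hnext
  let D : ℕ → {D // Inv D} := fun i => (fun D => (q D).2)^[i]
    ⟨{ C with crashedClients := Finset.univ.erase c, crashedObjects := B }, hop, rfl, rfl, hs, hno⟩
  have hDsucc : ∀ i, D (i + 1) = (q (D i)).2 := fun i => Function.iterate_succ_apply' _ _ _
  let Λ : ℕ → List (Act P V n) := fun i =>
    Nat.rec (α ++ γ) (fun i L => L ++ .step c :: (q (D i)).1) i
  have hΛsucc : ∀ i, Λ (i + 1) = Λ i ++ .step c :: (q (D i)).1 := fun i => rfl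
  have hΛ : ∀ i, Path A f (Config.initial A) (Λ i) (D i).1 := by
    intro i
    induction i with
    | zero => exact hp.append hγ
    | succ i ih => rw [hΛsucc, hDsucc]; exact ih.append (hq _)
  have hlen : ∀ i, i ≤ (Λ i).length := by
    intro i
    induction i with
    | zero => simp
    | succ i ih => rw [hΛsucc]; simp; omega
  have hpre : ∀ i j, i ≤ j → Λ i <+: Λ j := by
    intro i j hij
    induction j, hij using Nat.le_induction with
    | base => exact List.prefix_rfl
    | succ j _ ih => rw [hΛsucc]; exact ih.trans (List.prefix_append _ _)
  have htake' : ∀ i j t, i ≤ j → t ≤ (Λ i).length → (Λ j).take t = (Λ i).take t := by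
    intro i j t hij ht
    obtain ⟨s, hs⟩ := hpre i j hij
    rw [← hs, List.take_append_of_le_length ht]
  have htake : ∀ i j t, t ≤ (Λ i).length → t ≤ (Λ j).length → (Λ j).take t = (Λ i).take t := by
    intro i j t hi hj
    rcases le_total i j with h | h
    exacts [htake' i j t h hi, (htake' j i t h hj).symm]
  have hget : ∀ i j t, t < (Λ i).length → t < (Λ j).length → (Λ j)[t]? = (Λ i)[t]? := by
    intro i j t hi hj
    have := congrArg (fun L => L[t]?) (htake i j (t + 1) hi hj)
    simpa [List.getElem?_take] using this
  -- `Λ (t + 1)` has more than `t` actions, so neither the truncation nor the default is ever felt.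
  let cfg : ℕ → Config A := fun t => trace f (Config.initial A) ((Λ (t + 1)).take t)
  let act : ℕ → Act P V n := fun t => (Λ (t + 1)).getD t (.step c)
  have hcfg : ∀ i t, t ≤ (Λ i).length →
      cfg t = trace f (Config.initial A) ((Λ i).take t) := by
    intro i t ht
    simp only [cfg]
    rw [htake i (t + 1) t ht (by have := hlen (t + 1); omega)]
  have hact : ∀ i t, t < (Λ i).length → act t = (Λ i).getD t (.step c) := by
    intro i t ht
    simp only [act, List.getD_eq_getElem?_getD]
    rw [hget i (t + 1) t ht (by have := hlen (t + 1); omega)]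
  have hcD : ∀ i, cfg (Λ i).length = (D i).1 := by
    intro i
    rw [hcfg i _ le_rfl, List.take_length, (hΛ i).trace_eq]
  have hstep : ∀ t, Step A f (cfg t) (act t) (cfg (t + 1)) := by
    intro t
    have ht : t < (Λ (t + 1)).length := hlen (t + 1)
    rw [hcfg (t + 1) (t + 1) ht]
    have e : act t = (Λ (t + 1))[t] := List.getD_eq_getElem _ _ ht
    rw [e]
    exact (hΛ (t + 1)).step_trace ht
  have hrun : IsRun A f ⊤ cfg act := by
    refine ⟨?_, fun t _ => hstep t⟩
    simpa [cfg] using (Path.nil (A := A) (f := f) _).trace_eq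
  have hsub : ∀ s t, s ≤ t → (cfg s).crashedClients ⊆ (cfg t).crashedClients := by
    intro s t hst
    induction t, hst using Nat.le_induction with
    | base => exact subset_rfl
    | succ t _ ih => exact ih.trans (hstep t).crashedClients_subset
  have hcorr : ∀ d, CorrectClient cfg d → d = c := by
    intro d hd
    have := hd (Λ 0).length
    rw [hcD 0, (D 0).2.2.1] at this
    simpa using this
  have hc : CorrectClient cfg c := by
    intro t ht
    have := hsub t _ (hlen t) ht
    rw [hcD t, (D t).2.2.1] at this
    simp at this
  have hfair : Fair cfg act := by
    refine ⟨fun t k r hr hrc hro => ?_, fun d hd t => ?_⟩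
    · have hper : ∀ s, t ≤ s → ∃ r', (cfg s).rmws[k]? = some r' ∧ r'.client = r.client ∧
          r'.object = r.object := by
        intro s hs
        induction s, hs using Nat.le_induction with
        | base => exact ⟨r, hr, rfl, rfl⟩
        | succ s _ ih =>
          obtain ⟨r', h₁, h₂, h₃⟩ := ih
          obtain ⟨r'', h₁', h₂', h₃'⟩ := (hstep s).exists_rmw h₁
          exact ⟨r'', h₁', h₂'.trans h₂, h₃'.trans h₃⟩
      obtain ⟨r', h₁, h₂, h₃⟩ := hper _ (hlen t)
      refine ⟨_, r', h₁, ?_⟩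
      rw [hcD t] at h₁
      rcases (D t).2.2.2.2.1 r' (List.mem_of_getElem? h₁) (h₂.trans (hcorr _ hrc)) with h | h
      · have := hro (Λ t).length
        rw [hcD t, (D t).2.2.2.1, ← h₃] at this
        exact absurd h this
      · exact h
    · obtain rfl := hcorr d hd
      refine ⟨(Λ t).length, hlen t, ?_⟩
      rw [hact (t + 1) _ (by rw [hΛsucc]; simp), hΛsucc]
      simp [List.getD_eq_getElem?_getD]
  -- The promised return belongs to the only live client. Nothing is invoked afterwards, so that
  -- client stays without an operation, whereas `Inv` says that it is inside one at every `D i`.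
  obtain ⟨t, d, x, ht, h₁, h₂, h₃⟩ := hlf cfg act hrun hfair (Λ 0).length c hc
    (by rw [hcD 0]; exact (D 0).2.1)
  have hst := hstep t
  rw [h₁] at hst
  obtain rfl : d = c := by
    have := fun h => hst.notMem_crashedClients (hsub _ t ht h)
    rw [hcD 0, (D 0).2.2.1] at this
    simpa using this
  have hnone := hst.op_of_returns h₂ h₃
  have hrest : ∀ i, ∃ ρ, Λ i = Λ 0 ++ ρ ∧ ∀ a ∈ ρ, a.NotInvoke := by
    intro i
    induction i with
    | zero => exact ⟨[], by simp, by simp⟩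
    | succ i ih =>
      obtain ⟨ρ, h, hρ⟩ := ih
      refine ⟨ρ ++ .step d :: (q (D i)).1, by rw [hΛsucc, h, List.append_assoc], ?_⟩
      intro a ha
      simp only [List.mem_append, List.mem_cons] at ha
      rcases ha with ha | rfl | ha
      · exact hρ a ha
      · intro _ _; simp
      · exact hqi _ a ha
  have hni : ∀ s, (Λ 0).length ≤ s → (act s).NotInvoke := by
    intro s hs
    obtain ⟨ρ, h, hρ⟩ := hrest (s + 1)
    have hl := hlen (s + 1)
    have : act s ∈ ρ := by
      simp only [act, List.getD_eq_getElem?_getD]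
      rw [h] at hl ⊢
      rw [List.length_append] at hl
      rw [List.getElem?_append_right hs, List.getElem?_eq_getElem (by omega)]
      simp
    exact hρ _ this
  have hper : ∀ s, t + 1 ≤ s → (cfg s).op d = none := by
    intro s hs
    induction s, hs using Nat.le_induction with
    | base => exact hnone
    | succ s hs ih => exact (hstep s).op_eq_none (hni s (by omega)) ih
  exact (D (t + 1)).2.1
    ((congrArg (fun E => E.op d) (hcD (t + 1))).symm.trans (hper _ (hlen (t + 1))))

/-! ### Quiet configurations and fresh clients -/

/-- `C` is reachable without crashes and no operation is outstanding. -/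
def Quiet (f : ℕ) (C : Config A) : Prop :=
  (∃ α, Path A f (Config.initial A) α C) ∧ (∀ c, C.op c = none) ∧
    C.crashedClients = ∅ ∧ C.crashedObjects = ∅

/-- Client `c` is in its initial state and has triggered nothing. -/
def Fresh (C : Config A) (c : P) : Prop :=
  C.loc c = A.local₀ c ∧ ∀ r ∈ C.rmws, r.client ≠ c

/-- Running alone from `X`, client `c` returns for the first time after `k` steps, with
result `x`. -/
def FirstReturn (A : Algorithm.{u, v, w, w'} P V n) (B : Finset (Fin n)) (c : P)
    (X : A.Local × (Fin n → List Bool)) (k : ℕ) (x : V) : Prop :=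
  (A.onStep c ((soloStep A B c)^[k] X).1).2 = .ret x ∧
    ∀ i < k, ∀ y, (A.onStep c ((soloStep A B c)^[i] X).1).2 ≠ .ret y

theorem FirstReturn.unique {B : Finset (Fin n)} {c : P} {X : A.Local × (Fin n → List Bool)}
    {k k' : ℕ} {x x' : V} (h : FirstReturn A B c X k x) (h' : FirstReturn A B c X k' x') :
    x = x' := by
  rcases lt_trichotomy k k' with hk | rfl | hk
  · exact absurd h.1 (h'.2 k hk x)
  · have := h.1.symm.trans h'.1
    simpa using this
  · exact absurd h'.1 (h.2 k' hk x')

theorem exists_firstReturn {B : Finset (Fin n)} {c : P} {X : A.Local × (Fin n → List Bool)}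
    (h : ∃ k x, (A.onStep c ((soloStep A B c)^[k] X).1).2 = .ret x) :
    ∃ k x, FirstReturn A B c X k x := by
  classical
  obtain ⟨x, hx⟩ := Nat.find_spec h
  exact ⟨Nat.find h, x, hx, fun i hi y hy => Nat.find_min h hi ⟨y, hy⟩⟩

theorem initial_quiet : Quiet f (Config.initial A) :=
  ⟨⟨[], .nil _⟩, fun _ => rfl, rfl, rfl⟩

theorem initial_fresh (c : P) : Fresh (Config.initial A) c :=
  ⟨rfl, by simp [Config.initial]⟩

/-- The configuration after the invocation of an operation. -/
def Config.invoked (C : Config A) (c : P) (o : Op V) : Config A :=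
  { C with
    loc := Function.update C.loc c (A.onInvoke c (C.loc c) o)
    op := Function.update C.op c (some o) }

theorem Quiet.step_invoke {C : Config A} (h : Quiet f C) (c : P) (o : Op V) :
    Step A f C (.invoke c o) (C.invoked c o) :=
  .invoke C c o (by simp [h.2.2.1]) (h.2.1 c)

/-- The source of indistinguishability: a fresh client running alone depends on the configuration
only through the contents. -/
theorem invoked_view {C : Config A} {c : P} (hf : Fresh C c) (o : Op V) :
    ((C.invoked c o).loc c, (C.invoked c o).contents) =
      (A.onInvoke c (A.local₀ c) o, C.contents) := by
  simp [Config.invoked, hf.1]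

/-- `D` arises from `C` by actions of `c` alone, which trigger the RMWs `rs`. -/
def SoloExtension (c : P) (C D : Config A) (rs : List (RMW P n A.Resp)) : Prop :=
  D.rmws = C.rmws ++ rs ∧ (∀ r ∈ rs, r.client = c) ∧ (∀ d, d ≠ c → D.loc d = C.loc d)

theorem SoloExtension.fresh {c d : P} {C D : Config A} {rs : List (RMW P n A.Resp)}
    (h : SoloExtension c C D rs) (hd : d ≠ c) (hf : Fresh C d) : Fresh D d := by
  refine ⟨(h.2.2 d hd).trans hf.1, fun r hr => ?_⟩
  rw [h.1] at hr
  rcases List.mem_append.1 hr with hr | hr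
  · exact hf.2 r hr
  · rw [h.2.1 r hr]; exact hd.symm

/-- A client that runs alone completes its operation. -/
theorem FirstReturn.exists_path {C : Config A} {α₀ : List (Act P V n)}
    (hp : Path A f (Config.initial A) α₀ C) (hcc : C.crashedClients = ∅)
    (hco : C.crashedObjects = ∅) {c : P} (hop : C.op c ≠ none) (hops : ∀ d, d ≠ c → C.op d = none)
    {B : Finset (Fin n)} {k : ℕ} {x : V} (h : FirstReturn A B c (C.loc c, C.contents) k x) :
    ∃ α rs D, Path A f C α D ∧ (∀ a ∈ α, a.NotInvoke) ∧ Quiet f D ∧ SoloExtension c C D rs ∧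
      D.contents = ((soloStep A B c)^[k] (C.loc c, C.contents)).2 := by
  obtain ⟨α, rs, hα, hαi, hrs, -⟩ := exists_path_iterate (f := f) (by simp [hcc]) hop
    (B := B) (by simp [hco]) k h.2
  set X := (soloStep A B c)^[k] (C.loc c, C.contents) with hX
  have hret : ∃ l, A.onStep c ((C.extend c X rs).loc c) = (l, .ret x) := by
    refine ⟨(A.onStep c X.1).1, ?_⟩
    have : (C.extend c X rs).loc c = X.1 := by simp [Config.extend]
    rw [this, ← h.1]
  obtain ⟨l, hl⟩ := hret
  have hst := Step.ret (f := f) (C.extend c X rs) c l x (by simp [Config.extend, hcc]) hop hl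
  have hfin := hα.append (.single hst)
  refine ⟨_, rs, _, hfin, ?_, ⟨⟨_, hp.append hfin⟩, ?_, hcc, hco⟩, ⟨rfl, hrs, ?_⟩, rfl⟩
  · intro a ha
    simp only [List.mem_append, List.mem_singleton] at ha
    rcases ha with ha | rfl
    · exact hαi a ha
    · intro _ _; simp
  · intro d
    by_cases hd : d = c
    · subst hd; simp
    · simpa [Function.update, hd, Config.extend] using hops d hd
  · intro d hd
    simp [Function.update, hd, Config.extend]

theorem Fresh.settled {C : Config A} {c : P} (h : Fresh C c) (B : Finset (Fin n)) :
    Settled B c C.rmws :=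
  fun r hr hc => absurd hc (h.2 r hr)

theorem Quiet.exists_firstReturn [Fintype P] (hlf : LockFree A f) {C : Config A} (hC : Quiet f C)
    {c : P} (hc : Fresh C c) (o : Op V) :
    ∃ k x, FirstReturn A ∅ c (A.onInvoke c (A.local₀ c) o, C.contents) k x := by
  obtain ⟨⟨α, hα⟩, hop, hcc, hco⟩ := id hC
  have := hlf.exists_solo_ret (hα.append (.single (hC.step_invoke c o))) hcc hco (c := c)
    (by simp [Config.invoked]) (B := ∅) (by simp) (hc.settled ∅)
  rw [invoked_view hc] at this
  exact RegisterEmulation.exists_firstReturn this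

/-- A fresh client that runs alone completes its operation. -/
theorem Quiet.exists_complete {C : Config A} (hC : Quiet f C) {c : P} (hc : Fresh C c) {o : Op V}
    {k : ℕ} {x : V} (h : FirstReturn A ∅ c (A.onInvoke c (A.local₀ c) o, C.contents) k x) :
    ∃ α rs D, Path A f C (.invoke c o :: α) D ∧ (∀ a ∈ α, a.NotInvoke) ∧ Quiet f D ∧
      SoloExtension c C D rs ∧
      D.contents = ((soloStep A ∅ c)^[k] (A.onInvoke c (A.local₀ c) o, C.contents)).2 := by
  obtain ⟨⟨α, hα⟩, hop, hcc, hco⟩ := id hC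
  rw [← invoked_view hc] at h ⊢
  obtain ⟨β, rs, D, h₁, h₂, h₃, h₄, h₅⟩ :=
    h.exists_path (hα.append (.single (hC.step_invoke c o))) hcc hco
      (by simp [Config.invoked]) (fun d hd => by simpa [Config.invoked, hd] using hop d)
  exact ⟨β, rs, D, .cons (hC.step_invoke c o) h₁, h₂, h₃, ⟨h₄.1, h₄.2.1, fun d hd =>
    (h₄.2.2 d hd).trans (by simp [Config.invoked, hd])⟩, h₅⟩

theorem Quiet.lastWrite {C D : Config A} (hC : Quiet f C) {c : P} {x : V}
    {α : List (Act P V n)} (hp : Path A f C (.invoke c (.write x) :: α) D)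
    (hα : ∀ a ∈ α, a.NotInvoke) (hD : Quiet f D) : LastWrite f D x := by
  obtain ⟨⟨β, hβ⟩, hop, -⟩ := hC
  exact ⟨β, α, c, C, hβ, hop, hp, hD.2.1, hα⟩

/-- The contents determine the value of the last write. -/
theorem LastWrite.eq_of_contents_eq [Fintype P] {v₀ : V} (hreg : WeaklyRegular A f v₀)
    (hlf : LockFree A f) {C D : Config A} {x y : V} (hx : LastWrite f C x) (hy : LastWrite f D y)
    (hC : Quiet f C) (hD : Quiet f D) {c : P} (hcC : Fresh C c) (hcD : Fresh D c)
    (h : C.contents = D.contents) : x = y := by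
  have key : ∀ {E : Config A} {z z' : V} {k : ℕ}, LastWrite f E z → Quiet f E → Fresh E c →
      FirstReturn A ∅ c (A.onInvoke c (A.local₀ c) .read, E.contents) k z' → z' = z := by
    intro E z z' k hz hE hcE hret
    obtain ⟨⟨α, hα⟩, hop, hcc, hco⟩ := id hE
    rw [← invoked_view hcE] at hret
    obtain ⟨β, rs, hβ, hβi, -⟩ := exists_path_iterate (f := f) (C := E.invoked c .read) (c := c)
      (B := ∅) (by simp [Config.invoked, hcc]) (by simp [Config.invoked])
      (by simp [Config.invoked, hco]) k hret.2
    refine hz.read_eq hreg hβi (.cons (hE.step_invoke c .read) hβ) ?_ ?_ ?_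
    · simp [Config.extend, Config.invoked, hcc]
    · simp [Config.extend, Config.invoked]
    · simpa [Config.extend] using hret.1
  obtain ⟨k, z, hz⟩ := hC.exists_firstReturn hlf hcC .read
  rw [← key hx hC hcC hz]
  rw [h] at hz
  exact key hy hD hcD hz

/-- Either a fresh client that runs alone triggers only RMWs in `G`, or it can complete its
operation and leave behind a pending RMW that is not in `G`. -/
theorem Quiet.trigger_dichotomy [Fintype P] (hlf : LockFree A f) (hf : 1 ≤ f) {C : Config A}
    (hC : Quiet f C) {c : P} (hc : Fresh C c) (o : Op V)
    (G : Fin n → (List Bool → List Bool × A.Resp) → Prop) :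
    (∃ k x, FirstReturn A ∅ c (A.onInvoke c (A.local₀ c) o, C.contents) k x ∧
      ∀ i < k, ∀ b fn, (A.onStep c ((soloStep A ∅ c)^[i]
        (A.onInvoke c (A.local₀ c) o, C.contents)).1).2 = .trigger b fn → G b fn) ∨
    ∃ rs D, Quiet f D ∧ SoloExtension c C D rs ∧
      ∃ r ∈ rs, r.phase = .triggered ∧ ¬ G r.object r.fn := by
  obtain ⟨k, x, h⟩ := hC.exists_firstReturn hlf hc o
  by_cases hG : ∀ i < k, ∀ b fn, (A.onStep c ((soloStep A ∅ c)^[i]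
        (A.onInvoke c (A.local₀ c) o, C.contents)).1).2 = .trigger b fn → G b fn
  · exact .inl ⟨k, x, h, hG⟩
  · right
    push Not at hG
    obtain ⟨i, hi, b, fn, htr, hbad⟩ := hG
    obtain ⟨⟨α, hα⟩, hop, hcc, hco⟩ := id hC
    have hinv := hC.step_invoke c o
    rw [← invoked_view hc] at h htr
    obtain ⟨β, rs, hβ, -, hrs, hset⟩ := exists_path_iterate (f := f) (C := C.invoked c o) (c := c)
      (B := ∅) (by simp [Config.invoked, hcc]) (by simp [Config.invoked])
      (by simp [Config.invoked, hco]) i (fun j hj => h.2 j (by omega))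
    set X := (soloStep A ∅ c)^[i] ((C.invoked c o).loc c, (C.invoked c o).contents) with hX
    set E := (C.invoked c o).extend c X rs with hE
    have hEl : E.loc c = X.1 := by simp [hE, Config.extend]
    have hEo : E.op c ≠ none := by simp [hE, Config.extend, Config.invoked]
    have hEcc : E.crashedClients = ∅ := hcc
    have hEco : E.crashedObjects = ∅ := hco
    -- From step `i` on, `b` is blocked, so the RMW outside `G` stays pending. All earlier RMWs of
    -- `c` were answered, so the only blocked object is `b`, and `1 ≤ f` lets lock-freedom complete
    -- the operation.
    obtain ⟨γ, rs', hγ, -, hrs', hset', hlast⟩ := exists_path_soloStep (f := f) (C := E) (c := c)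
      (B := {b}) (by simp [hEcc]) hEo (by simp [hEco])
      (by rw [hEl]; exact h.2 i hi)
    rw [hEl] at hlast
    have hrs'' := hlast b fn htr (by simp)
    set E' := E.extend c (soloStep A {b} c (E.loc c, E.contents)) rs' with hE'
    have hpath := ((hα.append (.single hinv)).append hβ).append hγ
    have hE'o : E'.op c ≠ none := hEo
    have hE'r : E'.rmws = C.rmws ++ rs ++ rs' := rfl
    have hE's : Settled {b} c E'.rmws := by
      intro r hr hrc
      rw [hE'r] at hr
      rcases List.mem_append.1 hr with hr | hr
      · rcases List.mem_append.1 hr with hr | hr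
        · exact absurd hrc (hc.2 r hr)
        · rcases hset r hr hrc with h' | h'
          · simp at h'
          · exact .inr h'
      · exact hset' r hr hrc
    obtain ⟨k', x', hret⟩ := RegisterEmulation.exists_firstReturn
      (hlf.exists_solo_ret hpath hEcc hEco hE'o (B := {b}) (by simpa using hf) hE's)
    obtain ⟨δ, rs₃, D, -, -, hD, hext, -⟩ := hret.exists_path hpath hEcc hEco hE'o
      (fun d hd => by
        simpa [hE', hE, Config.extend, Config.invoked, hd] using hop d)
    refine ⟨rs ++ rs' ++ rs₃, D, hD, ⟨?_, ?_, ?_⟩, ⟨c, b, fn, .triggered⟩, ?_, rfl, hbad⟩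
    · rw [hext.1, hE'r]; simp
    · intro r hr
      simp only [List.mem_append] at hr
      rcases hr with (hr | hr) | hr
      exacts [hrs r hr, hrs' r hr, hext.2.1 r hr]
    · intro d hd
      rw [hext.2.2 d hd]
      simp [hE', hE, Config.extend, Config.invoked, hd]
    · simp [hrs'']

end Solo

/-! ### Short chains and effects on bounded contents -/

/-- A relation on a finite type: every chain can be shortened to fewer steps than there are
elements. -/
theorem exists_short_chain {T : Type*} [Fintype T] {R : T → T → Prop} {a b : T}
    (h : Relation.ReflTransGen R a b) :
    ∃ k < Fintype.card T, ∃ p : ℕ → T, p 0 = a ∧ p k = b ∧ ∀ i < k, R (p i) (p (i + 1)) := by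
  classical
  have hex : ∃ k, ∃ p : ℕ → T, p 0 = a ∧ p k = b ∧ ∀ i < k, R (p i) (p (i + 1)) := by
    induction h with
    | refl => exact ⟨0, fun _ => a, rfl, rfl, by simp⟩
    | @tail c d _ hcd ih =>
      obtain ⟨k, p, h₀, hk, hp⟩ := ih
      refine ⟨k + 1, fun i => if i ≤ k then p i else d, by simp [h₀], by simp, fun i hi => ?_⟩
      rcases Nat.lt_or_ge i k with h | h
      · simpa [h.le, Nat.succ_le_of_lt h] using hp i h
      · obtain rfl : i = k := by omega
        simpa [hk] using hcd
  refine ⟨Nat.find hex, ?_, Nat.find_spec hex⟩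
  obtain ⟨p, h₀, hk, hp⟩ := Nat.find_spec hex
  have hmin := fun j => Nat.find_min hex (m := j)
  set k := Nat.find hex
  by_contra! hcard
  obtain ⟨i, j, hij, he⟩ := Fintype.exists_ne_map_eq_of_card_lt
    (fun i : Fin (k + 1) => p i) (by simpa using Nat.lt_succ_of_le hcard)
  wlog hlt : i < j generalizing i j
  · exact this j i hij.symm he.symm (lt_of_le_of_ne (not_lt.1 hlt) hij.symm)
  have hlt' : (i : ℕ) < j := hlt
  have hj := j.2
  have he' : p i = p j := he
  -- Cut out the segment between the equal entries `p i` and `p j`.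
  refine hmin (k - (j - i)) (by omega)
    ⟨fun t => if t ≤ i then p t else p (t + (j - i)), by simp [h₀], ?_, fun t ht => ?_⟩
  · rcases Nat.lt_or_ge (i : ℕ) (k - (j - i)) with h | h
    · simp only [if_neg (not_le.2 h)]
      rw [show k - (j - i) + (j - i) = k by omega, hk]
    · have e : k - (j - i) = i := by omega
      have e' : (j : ℕ) = k := by omega
      simp only [e, le_refl, if_true]
      rw [he', e', hk]
  · rcases lt_trichotomy t (i : ℕ) with h | h | h
    · simpa [h.le, Nat.succ_le_of_lt h] using hp t (by omega)
    · subst h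
      have := hp j (by omega)
      rw [← he'] at this
      simpa [show (i : ℕ) + 1 + (j - i) = j + 1 by omega] using this
    · simpa [not_le.2 h, not_le.2 (show (i : ℕ) < t + 1 by omega),
        show t + 1 + (j - i : ℕ) = t + (j - i) + 1 by omega] using hp (t + (j - i)) (by omega)

/-- Bit strings of length at most `B`. -/
abbrev Bits (B : ℕ) := {l : List Bool // l.length ≤ B}

noncomputable instance (B : ℕ) : Fintype (Bits B) :=
  (List.finite_length_le Bool B).fintype

/-- The truncation of a bit string to length `B`. -/
def clip (B : ℕ) (l : List Bool) : Bits B := ⟨l.take B, by simp⟩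

theorem clip_val {B : ℕ} {l : List Bool} (h : l.length ≤ B) : (clip B l : List Bool) = l :=
  List.take_of_length_le h

/-- What an RMW can do to the contents of an object that stores at most `B` bits. -/
abbrev Effect (n B : ℕ) := Fin n × (Bits B → Option (Bits B))

noncomputable instance (n B : ℕ) : Fintype (Effect n B) := by classical infer_instance

/-- The effect of an RMW. -/
def effectOf {R : Type w'} (B : ℕ) (b : Fin n) (fn : List Bool → List Bool × R) : Effect n B :=
  -- The whole function is recorded, since a pending RMW acts on whatever contents it meets; `none`
  -- marks an overflow. Responses are dropped because they are not delivered when leftovers are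
  -- replayed.
  (b, fun s => if h : (fn s).1.length ≤ B then some ⟨(fn s).1, h⟩ else none)

/-- One change of the contents by an effect in `G`. -/
def EffectStep {B : ℕ} (G : Set (Effect n B)) (τ τ' : Fin n → Bits B) : Prop :=
  ∃ g ∈ G, ∃ s, g.2 (τ g.1) = some s ∧ τ' = Function.update τ g.1 s

/-! ### The stock of pending RMWs -/

section Stock

variable [DecidableEq P] {A : Algorithm.{u, v, w, w'} P V n} {f : ℕ} {B : ℕ}

open Classical in
/-- The number of pending RMWs with effect `g`. -/
noncomputable def stock (C : Config A) (g : Effect n B) : ℕ :=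
  C.rmws.countP fun r => decide (r.phase = .triggered ∧ effectOf B r.object r.fn = g)

theorem stock_le_of_append {C D : Config A} {rs : List (RMW P n A.Resp)}
    (h : D.rmws = C.rmws ++ rs) (g : Effect n B) : stock C g ≤ stock D g := by
  simp [stock, h, List.countP_append]

theorem stock_lt_of_append {C D : Config A} {rs : List (RMW P n A.Resp)}
    (h : D.rmws = C.rmws ++ rs) {r : RMW P n A.Resp} (hr : r ∈ rs) (hp : r.phase = .triggered) :
    stock C (effectOf B r.object r.fn) < stock D (effectOf B r.object r.fn) := by
  classical
  simp only [stock, h, List.countP_append, Nat.lt_add_right_iff_pos, List.countP_pos_iff]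
  exact ⟨r, hr, by simp [hp]⟩

/-- Pending RMWs take effect along a chain of contents. -/
theorem exists_path_of_chain {C : Config A} (hco : C.crashedObjects = ∅) {G : Set (Effect n B)}
    (k : ℕ) (p : ℕ → Fin n → Bits B) (h₀ : C.contents = fun b => (p 0 b : List Bool))
    (hp : ∀ i < k, EffectStep G (p i) (p (i + 1))) (hG : ∀ g ∈ G, k ≤ stock C g) :
    ∃ α D, Path A f C α D ∧ (∀ a ∈ α, a.NotInvoke) ∧ D.loc = C.loc ∧ D.op = C.op ∧
      D.crashedClients = C.crashedClients ∧ D.crashedObjects = C.crashedObjects ∧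
      (D.contents = fun b => (p k b : List Bool)) ∧
      ∀ r ∈ D.rmws, ∃ r' ∈ C.rmws, r'.client = r.client := by
  classical
  induction k generalizing C p with
  | zero => exact ⟨[], C, .nil C, by simp, rfl, rfl, rfl, rfl, h₀, fun r hr => ⟨r, hr, rfl⟩⟩
  | succ k ih =>
    obtain ⟨g, hg, s, hs, hs'⟩ := hp 0 (by omega)
    have hpos : 0 < stock C g := lt_of_lt_of_le (Nat.succ_pos k) (hG g hg)
    rw [stock, List.countP_pos_iff] at hpos
    obtain ⟨r, hr, hr'⟩ := hpos
    simp only [decide_eq_true_eq] at hr'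
    obtain ⟨hph, rfl⟩ := hr'
    obtain ⟨l₁, l₂, hl⟩ := List.append_of_mem hr
    have hst := Step.effect (f := f) C l₁.length r (by simp [hl]) hph (by simp [hco])
    have hfn : (r.fn (C.contents r.object)).1 = s := by
      simp only [effectOf] at hs
      split at hs
      · rw [h₀, ← Option.some.inj hs]
      · simp at hs
    have hset : ∀ r', C.rmws.set l₁.length r' = l₁ ++ r' :: l₂ := by
      intro r'; simp [hl]
    obtain ⟨α, D, hD, hα, e₁, e₂, e₃, e₄, e₅, e₆⟩ := ih (C := { C with
          contents := Function.update C.contents r.object (r.fn (C.contents r.object)).1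
          rmws := C.rmws.set l₁.length
            { r with phase := .applied (r.fn (C.contents r.object)).2 } }) hco
      (fun i => p (i + 1))
      (by
        funext b
        simp only [hfn]
        rw [hs']
        by_cases hb : b = r.object
        · subst hb; simp [effectOf]
        · have : b ≠ (effectOf B r.object r.fn).1 := hb
          rw [Function.update_of_ne hb, Function.update_of_ne this, h₀])
      (fun i hi => hp (i + 1) (by omega))
      -- Using up one pending RMW lowers each stock by at most one, and one step fewer remains.
      (fun g' hg' => by
        have h' := hG g' hg'
        simp only [stock] at h' ⊢
        rw [hset]
        rw [hl] at h'
        simp only [List.countP_append, List.countP_cons] at h' ⊢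
        split at h' <;> simp at h' ⊢ <;> omega)
    refine ⟨_, D, .cons hst hD, ?_, e₁, e₂, e₃, e₄, e₅, fun r' hr' => ?_⟩
    · intro a ha
      rcases List.mem_cons.1 ha with rfl | ha
      · intro _ _; simp
      · exact hα a ha
    · obtain ⟨r'', h₁, h₂⟩ := e₆ r' hr'
      simp only [hset, List.mem_append, List.mem_cons] at h₁
      rcases h₁ with h₁ | rfl | h₁
      · exact ⟨r'', by simp [hl, h₁], h₂⟩
      · exact ⟨r, hr, h₂⟩
      · exact ⟨r'', by simp [hl, h₁], h₂⟩

/-- Under the length bounds clipping loses nothing, so a solo step either keeps the contents or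
changes them by the effect of the RMW it triggers. -/
theorem soloStep_contents {c : P} {X : A.Local × (Fin n → List Bool)} (G : Set (Effect n B))
    (hX : ∀ b, (X.2 b).length ≤ B) (hX' : ∀ b, ((soloStep A ∅ c X).2 b).length ≤ B)
    (hG : ∀ b fn, (A.onStep c X.1).2 = .trigger b fn → effectOf B b fn ∈ G) :
    Relation.ReflTransGen (EffectStep G) (fun b => clip B (X.2 b))
      (fun b => clip B ((soloStep A ∅ c X).2 b)) := by
  unfold soloStep at hX' ⊢
  cases he : A.onStep c X.1 with
  | mk l out =>
    cases out with
    | ret x => exact .refl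
    | skip => exact .refl
    | trigger b fn =>
      refine .single ⟨_, hG b fn (by rw [he]), clip B (fn (X.2 b)).1, ?_, ?_⟩
      · have hb : (fn (X.2 b)).1.length ≤ B := by simpa [he] using hX' b
        have h₁ : (clip B (X.2 b) : List Bool) = X.2 b := clip_val (hX b)
        simp only [effectOf]
        rw [dif_pos (by rw [h₁]; exact hb)]
        refine congrArg some (Subtype.ext ?_)
        change (fn (clip B (X.2 b) : List Bool)).1 = _
        rw [h₁, clip_val hb]
      · funext d
        by_cases hd : d = b
        · subst hd; simp [effectOf]
        · have : d ≠ (effectOf B b fn).1 := hd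
          simp [Function.update_of_ne hd, Function.update_of_ne this]

/-- The stock of pending RMWs, truncated. -/
noncomputable def potential (B N : ℕ) (C : Config A) : ℕ :=
  ∑ g : Effect n B, min N (stock C g)

theorem potential_le (N : ℕ) (C : Config A) :
    potential B N C ≤ N * Fintype.card (Effect n B) := by
  rw [potential, mul_comm, ← smul_eq_mul, ← Finset.card_univ]
  exact Finset.sum_le_card_nsmul _ _ _ fun g _ => min_le_left _ _

/-- If at most `B` bits are ever stored in an object, then two fresh clients can increase the
stock of pending RMWs. -/
theorem Quiet.exists_potential_lt [Fintype P] {v₀ : V} (hreg : WeaklyRegular A f v₀)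
    (hlf : LockFree A f) (hf : 1 ≤ f)
    (hB : ∀ C : Config A, Reachable A f C → ∀ b, (C.contents b).length ≤ B)
    {x y : V} (hxy : x ≠ y) {C : Config A} (hC : Quiet f C) {c₁ c₂ c₃ : P} (h₁ : Fresh C c₁)
    (h₂ : Fresh C c₂) (h₃ : Fresh C c₃) (h₁₂ : c₁ ≠ c₂) (h₁₃ : c₁ ≠ c₃) (h₂₃ : c₂ ≠ c₃) :
    ∃ D : Config A, Quiet f D ∧ (∀ d, d ≠ c₁ → d ≠ c₂ → Fresh C d → Fresh D d) ∧
      potential B (Fintype.card (Fin n → Bits B)) C <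
        potential B (Fintype.card (Fin n → Bits B)) D := by
  set N := Fintype.card (Fin n → Bits B) with hN
  obtain ⟨k, z, hret⟩ := hC.exists_firstReturn hlf h₁ (.write x)
  obtain ⟨α, rs, E, hE, hα, hEq, hEx, -⟩ := hC.exists_complete h₁ hret
  have hEw : LastWrite f E x := hC.lastWrite hE hα hEq
  have h₂E : Fresh E c₂ := hEx.fresh h₁₂.symm h₂
  have h₃E : Fresh E c₃ := hEx.fresh h₁₃.symm h₃
  rcases hEq.trigger_dichotomy hlf hf h₂E (.write y)
    (fun b fn => N ≤ stock E (effectOf B b fn)) with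
      ⟨k, z, hret, hgood⟩ | ⟨rs', D, hD, hDx, r, hr, hph, hbad⟩
  -- Every effect used by the write of `y` is stocked `N` times after the write of `x`. Compare `F`,
  -- reached by performing that write, with `D`, reached by replaying its changes of contents from
  -- the stock.
  · exfalso
    obtain ⟨β, rs', F, hF, hβ, hFq, hFx, hFc⟩ := hEq.exists_complete h₂E hret
    have hFw : LastWrite f F y := hEq.lastWrite hF hβ hFq
    set X := (A.onInvoke c₂ (A.local₀ c₂) (.write y), E.contents) with hX
    have hbound : ∀ i ≤ k, ∀ b, (((soloStep A ∅ c₂)^[i] X).2 b).length ≤ B := by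
      intro i hi b
      obtain ⟨⟨γ, hγ⟩, hop, hcc, hco⟩ := id hEq
      have hv := invoked_view h₂E (.write y)
      obtain ⟨δ, rs, hδ, -⟩ := exists_path_iterate (f := f) (C := E.invoked c₂ (.write y))
        (c := c₂) (B := ∅) (by simp [Config.invoked, hcc]) (by simp [Config.invoked])
        (by simp [Config.invoked, hco]) i
        (fun j hj => by rw [hv]; exact hret.2 j (by omega))
      rw [hv] at hδ
      exact hB _ ((hγ.append (.single (hEq.step_invoke c₂ (.write y)))).append hδ).reachable b
    have hchain : ∀ i ≤ k, Relation.ReflTransGen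
        (EffectStep {g : Effect n B | N ≤ stock E g}) (fun b => clip B (E.contents b))
        (fun b => clip B (((soloStep A ∅ c₂)^[i] X).2 b)) := by
      intro i
      induction i with
      | zero => intro _; exact .refl
      | succ i ih =>
        intro hi
        refine (ih (by omega)).trans ?_
        have := hbound (i + 1) hi
        rw [Function.iterate_succ_apply'] at this ⊢
        exact soloStep_contents _ (hbound i (by omega)) this (hgood i hi)
    -- Now `j < N`, so the stock suffices even if one effect is used at every step.
    obtain ⟨j, hj, p, hp₀, hpj, hp⟩ := exists_short_chain (hchain k le_rfl)
    obtain ⟨γ, D, hD, hγ, e₁, e₂, e₃, e₄, e₅, e₆⟩ := exists_path_of_chain (f := f)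
      hEq.2.2.2 j p
      (by
        funext b
        rw [hp₀]
        exact (clip_val (hbound 0 (by omega) b)).symm) hp (fun g hg => hj.le.trans hg)
    have hDq : Quiet f D := by
      obtain ⟨⟨δ, hδ⟩, hop, hcc, hco⟩ := id hEq
      exact ⟨⟨_, hδ.append hD⟩, fun d => by rw [e₂]; exact hop d, e₃.trans hcc, e₄.trans hco⟩
    have h₃D : Fresh D c₃ := by
      refine ⟨by rw [e₁]; exact h₃E.1, fun r hr => ?_⟩
      obtain ⟨r', hr', e⟩ := e₆ r hr
      rw [← e]
      exact h₃E.2 r' hr'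
    refine hxy ((hEw.path hγ hD).eq_of_contents_eq hreg hlf hFw hDq hFq h₃D
      (hFx.fresh h₂₃.symm h₃E) ?_)
    rw [e₅, hFc, hpj]
    funext b
    exact clip_val (hbound k le_rfl b)
  · refine ⟨D, hD, fun d hd₁ hd₂ hd => hDx.fresh hd₂ (hEx.fresh hd₁ hd), ?_⟩
    have hle : ∀ g : Effect n B, stock C g ≤ stock D g := fun g =>
      (stock_le_of_append hEx.1 g).trans (stock_le_of_append hDx.1 g)
    -- The new leftover has an effect whose stock was below `N`, so its truncated count really
    -- rises.
    refine Finset.sum_lt_sum (fun g _ => min_le_min_left N (hle g))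
      ⟨effectOf B r.object r.fn, Finset.mem_univ _, ?_⟩
    have a₁ := stock_le_of_append hEx.1 (effectOf B r.object r.fn)
    have a₂ := stock_lt_of_append (B := B) hDx.1 hr hph
    have a₃ := not_le.1 hbad
    simp only [lt_min_iff, min_lt_iff]
    omega

/-- With enough clients, an algorithm that tolerates the crash of a base object cannot keep the
number of bits stored in each object below a bound. -/
theorem exists_reachable_length_gt [Fintype P] {v₀ : V} (hreg : WeaklyRegular A f v₀)
    (hlf : LockFree A f) (hf : 1 ≤ f) [Nontrivial V]
    (hP : 2 * (Fintype.card (Fin n → Bits B) * Fintype.card (Effect n B) + 1) + 1 ≤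
      Fintype.card P) :
    ∃ C : Config A, Reachable A f C ∧ ∃ b, B < (C.contents b).length := by
  by_contra! hB
  obtain ⟨x, y, hxy⟩ := exists_pair_ne V
  -- Each round consumes two writers; one further fresh client must remain as the reader.
  have key : ∀ j, 2 * j + 1 ≤ Fintype.card P → ∃ (C : Config A) (U : Finset P), Quiet f C ∧
      U.card ≤ 2 * j ∧ (∀ d, d ∉ U → Fresh C d) ∧
      j ≤ potential B (Fintype.card (Fin n → Bits B)) C := by
    intro j
    induction j with
    | zero =>
      exact fun _ => ⟨_, ∅, initial_quiet, by simp, fun d _ => initial_fresh d, Nat.zero_le _⟩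
    | succ j ih =>
      intro hj
      obtain ⟨C, U, hC, hU, hfresh, hpot⟩ := ih (by omega)
      have hcard : 2 < Uᶜ.card := by rw [Finset.card_compl]; omega
      obtain ⟨c₁, c₂, c₃, m₁, m₂, m₃, h₁₂, h₁₃, h₂₃⟩ := Finset.two_lt_card_iff.1 hcard
      rw [Finset.mem_compl] at m₁ m₂ m₃
      obtain ⟨D, hD, hDf, hlt⟩ := hC.exists_potential_lt hreg hlf hf hB hxy (hfresh _ m₁)
        (hfresh _ m₂) (hfresh _ m₃) h₁₂ h₁₃ h₂₃
      refine ⟨D, insert c₁ (insert c₂ U), hD, ?_, fun d hd => ?_, by omega⟩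
      · have a₁ := Finset.card_insert_le c₁ (insert c₂ U)
        have a₂ := Finset.card_insert_le c₂ U
        omega
      · simp only [Finset.mem_insert, not_or] at hd
        exact hDf d hd.1 hd.2.1 (hfresh d hd.2.2)
  obtain ⟨C, -, -, -, -, hpot⟩ := key _ hP
  have := potential_le (B := B) (Fintype.card (Fin n → Bits B)) C
  omega

end Stock

/-! ### Counting self-delimiting contents -/

section SelfDelimiting

/-- The first blocks are prefixes of the same string, hence comparable, hence equal, and can be
cancelled. The tails `p` and `q` absorb padding of different lengths. -/
theorem eq_of_flatten_append_eq {X Y : List (List Bool)} {p q : List Bool}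
    (h : List.Forall₂ (fun x y => (x <+: y → x = y) ∧ (y <+: x → y = x)) X Y)
    (he : X.flatten ++ p = Y.flatten ++ q) : X = Y := by
  induction h with
  | nil => rfl
  | @cons x y X Y hxy _ ih =>
    simp only [List.flatten_cons, List.append_assoc] at he
    have hx : x <+: y ++ (Y.flatten ++ q) := ⟨_, he⟩
    have hxy' : x = y := by
      rcases List.prefix_or_prefix_of_prefix hx (List.prefix_append y _) with h' | h'
      exacts [hxy.1 h', (hxy.2 h').symm]
    subst hxy'
    rw [ih (List.append_cancel_left he)]

variable [DecidableEq P] {A : Algorithm.{u, v, w, w'} P V n} {f : ℕ}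

/-- If the contents are self-delimiting, then some configuration stores enough bits to identify
every value. -/
theorem SelfDelimiting.exists_card_le [Fintype P] [Fintype V] {v₀ : V}
    (hreg : WeaklyRegular A f v₀) (hlf : LockFree A f) (hsd : SelfDelimiting A f)
    (hP : 2 ≤ Fintype.card P) :
    ∃ C : Config A, Reachable A f C ∧ Fintype.card V ≤ 2 ^ C.storage := by
  obtain ⟨c₁, c₂, hc⟩ := Fintype.exists_pair_of_one_lt_card hP
  have hex : ∀ x : V, ∃ D : Config A, Quiet f D ∧ LastWrite f D x ∧ Fresh D c₂ := by
    intro x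
    obtain ⟨k, z, hret⟩ := (initial_quiet (A := A) (f := f)).exists_firstReturn hlf
      (initial_fresh c₁) (.write x)
    obtain ⟨α, rs, E, hE, hα, hEq, hEx, -⟩ :=
      (initial_quiet (A := A) (f := f)).exists_complete (initial_fresh c₁) hret
    exact ⟨E, hEq, initial_quiet.lastWrite hE hα hEq, hEx.fresh hc.symm (initial_fresh c₂)⟩
  choose D hq hw hf using hex
  have hreach : ∀ x, Reachable A f (D x) := fun x => (hq x).1.choose_spec.reachable
  have : Nonempty V := ⟨v₀⟩
  -- Padding to the largest storage gives all values codes of the same length; self-delimitation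
  -- makes it unnecessary to mark where the padding starts.
  obtain ⟨x₀, hx₀⟩ := Finite.exists_max fun x => (D x).storage
  refine ⟨D x₀, hreach x₀, ?_⟩
  set L := (D x₀).storage
  let code : V → List Bool := fun x => (List.ofFn (D x).contents).flatten
  have hcode : ∀ x, (code x).length = (D x).storage := by
    intro x
    simp [code, Config.storage, List.length_flatten, List.sum_ofFn]
  let pad : V → List.Vector Bool L := fun x =>
    ⟨code x ++ List.replicate (L - (code x).length) false, by
      have := hx₀ x
      rw [List.length_append, List.length_replicate, hcode]
      omega⟩
  have hinj : Function.Injective pad := by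
    intro x y hxy
    have h := eq_of_flatten_append_eq (List.forall₂_iff_get.2 ⟨by simp, fun i h₁ h₂ => by
      simpa using ⟨hsd _ _ (hreach x) (hreach y) _, hsd _ _ (hreach y) (hreach x) _⟩⟩)
      (congrArg Subtype.val hxy)
    exact (hw x).eq_of_contents_eq hreg hlf (hw y) (hq x) (hq y) (hf x) (hf y)
      (List.ofFn_injective h)
  simpa [card_vector] using Fintype.card_le_of_injective pad hinj

end SelfDelimiting

end RegisterEmulation

/-! ### The lower bound -/

theorem mainTheorem2 (n f : ℕ) (hf : 2 * f < n) (V : Type v) [Fintype V] (v₀ : V) :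
    ∃ m : ℕ, ∀ (P : Type u) [Fintype P] [DecidableEq P], m ≤ Fintype.card P →
      ∀ A : RegisterEmulation.Algorithm.{u, v, w, w'} P V n,
        RegisterEmulation.WeaklyRegular A f v₀ →
        RegisterEmulation.LockFree A f →
        (f = 0 → RegisterEmulation.SelfDelimiting A f) →
        ∃ C : RegisterEmulation.Config A, RegisterEmulation.Reachable A f C ∧
          ((f : ℝ) + 1) * Real.logb 2 (Fintype.card V) ≤ (C.storage : ℝ) := by
  open RegisterEmulation in
  have : Nonempty V := ⟨v₀⟩
  set B := ⌈((f : ℝ) + 1) * Real.logb 2 (Fintype.card V)⌉₊ with hBdef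
  -- Two clients for each of one more round than the truncated stock can grow, plus a reader.
  refine ⟨2 * (Fintype.card (Fin n → Bits B) * Fintype.card (Effect n B) + 1) + 1, ?_⟩
  intro P _ _ hP A hreg hlf hsd
  rcases Nat.eq_zero_or_pos f with rfl | hpos
  · obtain ⟨C, hC, hcard⟩ := (hsd rfl).exists_card_le hreg hlf (by omega)
    refine ⟨C, hC, ?_⟩
    have h0 : (0 : ℝ) < Fintype.card V := by exact_mod_cast Fintype.card_pos
    simp only [Nat.cast_zero, zero_add, one_mul]
    rw [Real.logb_le_iff_le_rpow one_lt_two h0, Real.rpow_natCast]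
    exact_mod_cast hcard
  · rcases subsingleton_or_nontrivial V with hV | hV
    · refine ⟨Config.initial A, (Path.nil (f := f) _).reachable, ?_⟩
      have : Fintype.card V = 1 :=
        le_antisymm (Fintype.card_le_one_iff_subsingleton.2 hV) Fintype.card_pos
      simp [this]
    -- A single object already exceeds the target `B`.
    · obtain ⟨C, hC, b, hb⟩ := exists_reachable_length_gt (B := B) hreg hlf hpos hP
      refine ⟨C, hC, (Nat.le_ceil _).trans ?_⟩
      have : (C.contents b).length ≤ C.storage :=
        Finset.single_le_sum (f := fun b => (C.contents b).length) (fun _ _ => Nat.zero_le _)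
          (Finset.mem_univ b)
      exact Nat.cast_le.2 (hb.le.trans this)
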